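/- Let $k$, $m$, $N$ be positive integers with $m$ square-free, and put $\Gamma=\Gamma_0(mN)$. Let $J_{k,m}(\Gamma)$ be the space of Jacobi forms of weight $k$ and index $m$ for $\Gamma\ltimes\mathbb Z^2$ with trivial character, that is, of holomorphic functions $\phi:\mathbb H\times\mathbb C\to\mathbb C$ such that (i) $\phi|_{k,m}\gamma=\phi$ for all $\gamma\in\Gamma$, where for $\gamma=\begin{pmatrix}a&b\\c&d\end{pmatrix}\in SL_2(\mathbb Z)$ $$(\phi|_{k,m}\gamma)(\tau,z)=(c\tau+d)^{-k}e^{-2\pi i m\frac{cz^2}{c\tau+d}}\,\phi\Big(\frac{a\tau+b}{c\tau+d},\frac z{c\tau+d}\Big);$$ (ii) $\phi(\tau,z+\lambda\tau+\mu)=e^{-2\pi i m(\lambda^2\tau+2\lambda z)}\phi(\tau,z)$ for all $\lambda,\mu\in\mathbb Z$; (iii) for every $\gamma\in SL_2(\mathbb Z)$ the function $\phi|_{k,m}\gamma$ has a Fourier expansion $\sum c(n,r)e^{2\pi i(n\tau+rz)}$ over $n\in\frac1{mN}\mathbb Z$, $r\in\mathbb Z$, with $c(n,r)=0$ unless $4mn\ge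 r^2$. Every $\phi\in J_{k,m}(\Gamma)$ can be written uniquely as $\phi(\tau,z)=\sum_{r=0}^{2m-1}h_{m,r}(\tau)\theta^J_{m,r}(\tau,z)$ with $$\theta^J_{m,r}(\tau,z)=\sum_{n\in\mathbb Z}e^{2\pi i m\left((n+\frac r{2m})^2\tau+2(n+\frac r{2m})z\right)}.$$ Let $J^*_{k,m}(\Gamma)\subseteq J_{k,m}(\Gamma)$ be the subspace of those $\phi$ with $h_{m,r}=0$ for all $r\ne 0,m$. Put $$(D_0\phi)(\tau)=\phi(\tau,0),\qquad (D_2\phi)(\tau)=\Big(\frac{k}{2\pi i}\frac{\partial^2\phi}{\partial z^2}-2m\frac{\partial\phi}{\partial\tau}\Big)(\tau,0).$$ Then $\phi\mapsto(D_0\phi,D_2\phi)$ is a well-defined injective linear map $$D_0\oplus D_2:\;J^*_{k,m}(\Gamma_0(mN))\longrightarrow M_k(\Gamma_0(mN))\oplus S_{k+2}(\Gamma_0(mN)),$$ where $M_k$ and $S_{k+2}$ denote the spaces of modular forms of weight $k$ and of cusp forms of weight $k+2$ with trivial character. -/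

import Mathlib

open UpperHalfPlane
open scoped MatrixGroups

noncomputable section

/-- The weight `k`, index `m` action of `γ = (a b; c d) ∈ SL₂(ℤ)` on functions on `ℍ × ℂ`:
`(φ|γ)(τ, z) = (cτ+d)^(-k) e^(-2πi m c z² / (cτ+d)) φ((aτ+b)/(cτ+d), z/(cτ+d))`. -/
def jacobiSlash (k : ℤ) (m : ℕ) (γ : SL(2, ℤ)) (φ : ℍ → ℂ → ℂ) (τ : ℍ) (z : ℂ) : ℂ :=
  denom γ τ ^ (-k) *
    Complex.exp (-(2 * Real.pi * Complex.I * m * ((γ 1 0 : ℤ) : ℂ) * z ^ 2 / denom γ τ)) *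
    φ (γ • τ) (z / denom γ τ)

/-- Jacobi forms of weight `k` and index `m` for the Jacobi group `Γ₀(M) ⋉ ℤ²` (with trivial
character). Since `Γ₀(M)` contains the principal congruence subgroup of level `M`, the Fourier
expansion at every cusp is in powers of `e^(2πiτ/M)`, and the exponent of
`e^(2πiτ)` is the rational number `n / M`. -/
structure IsJacobiForm (k : ℤ) (m M : ℕ) (φ : ℍ → ℂ → ℂ) : Prop where
  /-- `φ` is holomorphic on `ℍ × ℂ`. -/
  holo : DifferentiableOn ℂ (fun p : ℂ × ℂ => φ (ofComplex p.1) p.2) {p | 0 < p.1.im}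
  /-- invariance under `Γ₀(M)` -/
  slash : ∀ γ ∈ CongruenceSubgroup.Gamma0 M, ∀ τ z, jacobiSlash k m γ φ τ z = φ τ z
  /-- invariance under the lattice translations `z ↦ z + λτ + μ` -/
  elliptic : ∀ (l μ : ℤ) (τ : ℍ) (z : ℂ),
    φ τ (z + l * τ + μ) =
      Complex.exp (-(2 * Real.pi * Complex.I * m * (l ^ 2 * τ + 2 * l * z))) * φ τ z
  /-- For every `γ ∈ SL₂(ℤ)` one has
  `φ|γ = ∑ c(n, r) e^(2πi (n/M) τ) e^(2πi r z)` with `c(n, r) = 0` unless `4m(n/M) ≥ r²`. -/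
  fourier : ∀ γ : SL(2, ℤ), ∃ c : ℤ × ℤ → ℂ,
    (∀ n r : ℤ, 4 * m * n < M * r ^ 2 → c (n, r) = 0) ∧
    ∀ (τ : ℍ) (z : ℂ), HasSum
      (fun p : ℤ × ℤ => c p *
        Complex.exp (2 * Real.pi * Complex.I * ((p.1 : ℂ) / M * τ + p.2 * z)))
      (jacobiSlash k m γ φ τ z)

/-- The theta series
`θ^J_{m,r}(τ, z) = ∑_{n ∈ ℤ} e^(2πi m ((n + r/2m)² τ + 2 (n + r/2m) z))`. -/
def thetaJ (m r : ℕ) (τ : ℍ) (z : ℂ) : ℂ :=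
  ∑' n : ℤ, Complex.exp (2 * Real.pi * Complex.I * m *
    (((n : ℂ) + r / (2 * m)) ^ 2 * τ + 2 * ((n : ℂ) + r / (2 * m)) * z))

/-- `h = (h_{m,r})_{0 ≤ r < 2m}` is the family of coefficients of the theta decomposition
`φ(τ, z) = ∑_{0 ≤ r < 2m} h_{m,r}(τ) θ^J_{m,r}(τ, z)`. Every Jacobi form of index `m` has exactly
one such family. -/
def IsThetaDecomposition (m : ℕ) (φ : ℍ → ℂ → ℂ) (h : ℕ → ℍ → ℂ) : Prop :=
  ∀ (τ : ℍ) (z : ℂ), φ τ z = ∑ r ∈ Finset.range (2 * m), h r τ * thetaJ m r τ z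

lemma jacobiSlash_add (k : ℤ) (m : ℕ) (γ : SL(2, ℤ)) (φ ψ : ℍ → ℂ → ℂ) (τ : ℍ) (z : ℂ) :
    jacobiSlash k m γ (φ + ψ) τ z = jacobiSlash k m γ φ τ z + jacobiSlash k m γ ψ τ z := by
  simp only [jacobiSlash, Pi.add_apply]; ring

lemma jacobiSlash_smul (k : ℤ) (m : ℕ) (γ : SL(2, ℤ)) (a : ℂ) (φ : ℍ → ℂ → ℂ) (τ : ℍ) (z : ℂ) :
    jacobiSlash k m γ (a • φ) τ z = a * jacobiSlash k m γ φ τ z := by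
  simp only [jacobiSlash, Pi.smul_apply, smul_eq_mul]; ring

/-- The space `J_{k,m}(Γ₀(M))` of Jacobi forms. -/
def jacobiForms (k : ℤ) (m M : ℕ) : Submodule ℂ (ℍ → ℂ → ℂ) where
  carrier := {φ | IsJacobiForm k m M φ}
  zero_mem' :=
    { holo := by simp
      slash := by simp [jacobiSlash]
      elliptic := by simp
      fourier := fun γ => ⟨0, by simp, by simp [jacobiSlash, hasSum_zero]⟩ }
  add_mem' := by
    intro φ ψ hφ hψ
    refine ⟨?_, ?_, ?_, ?_⟩
    · exact hφ.holo.add hψ.holo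
    · intro γ hγ τ z
      rw [jacobiSlash_add, hφ.slash γ hγ, hψ.slash γ hγ]; rfl
    · intro l μ τ z
      simp only [Pi.add_apply, hφ.elliptic, hψ.elliptic]; ring
    · intro γ
      obtain ⟨c, hc, hs⟩ := hφ.fourier γ
      obtain ⟨d, hd, ht⟩ := hψ.fourier γ
      refine ⟨c + d, fun n r h => by simp [hc n r h, hd n r h], fun τ z => ?_⟩
      rw [jacobiSlash_add]
      convert (hs τ z).add (ht τ z) using 2 with p
      simp only [Pi.add_apply]; ring
  smul_mem' := by
    intro a φ hφ
    refine ⟨?_, ?_, ?_, ?_⟩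
    · exact hφ.holo.const_smul a
    · intro γ hγ τ z
      rw [jacobiSlash_smul, hφ.slash γ hγ]; rfl
    · intro l μ τ z
      change a * φ τ (z + l * τ + μ) = _ * (a * φ τ z)
      rw [hφ.elliptic]; ring
    · intro γ
      obtain ⟨c, hc, hs⟩ := hφ.fourier γ
      refine ⟨a • c, fun n r h => by simp [hc n r h], fun τ z => ?_⟩
      rw [jacobiSlash_smul]
      simpa only [Pi.smul_apply, smul_eq_mul, mul_assoc] using (hs τ z).mul_left a

/-- The subspace `J*_{k,m}(Γ₀(M))` of those Jacobi forms for which `h_{m,r} = 0` for all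
`0 ≤ r < 2m` with `r ≠ 0, m`. -/
def jacobiFormsStar (k : ℤ) (m M : ℕ) : Submodule ℂ (ℍ → ℂ → ℂ) where
  carrier := {φ | φ ∈ jacobiForms k m M ∧ ∃ h : ℕ → ℍ → ℂ, IsThetaDecomposition m φ h ∧
    ∀ r < 2 * m, r ≠ 0 → r ≠ m → h r = 0}
  zero_mem' := ⟨Submodule.zero_mem _, 0, by simp [IsThetaDecomposition], by simp⟩
  add_mem' := by
    rintro φ ψ ⟨hφ, h, hd, h0⟩ ⟨hψ, g, gd, g0⟩
    refine ⟨Submodule.add_mem _ hφ hψ, h + g, fun τ z => ?_, fun r hr h1 h2 => ?_⟩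
    · simp only [Pi.add_apply, hd τ z, gd τ z, add_mul, Finset.sum_add_distrib]
    · simp [h0 r hr h1 h2, g0 r hr h1 h2]
  smul_mem' := by
    rintro a φ ⟨hφ, h, hd, h0⟩
    refine ⟨Submodule.smul_mem _ a hφ, a • h, fun τ z => ?_, fun r hr h1 h2 => ?_⟩
    · simp only [Pi.smul_apply, smul_eq_mul, hd τ z, Finset.mul_sum, mul_assoc]
    · simp [h0 r hr h1 h2]

/-- The restriction map `(D₀ φ)(τ) = φ(τ, 0)`. -/
def jacobiD0 (φ : ℍ → ℂ → ℂ) (τ : ℍ) : ℂ := φ τ 0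

/-- The differential operator `D₂ = (k/(2πi) ∂²/∂z² - 2m ∂/∂τ)|_{z=0}` on functions on `ℍ × ℂ`. -/
def jacobiD2 (k : ℤ) (m : ℕ) (φ : ℍ → ℂ → ℂ) (τ : ℍ) : ℂ :=
  k / (2 * Real.pi * Complex.I) * iteratedDeriv 2 (fun z : ℂ => φ τ z) 0 -
    2 * m * deriv (fun w : ℂ => φ (ofComplex w) 0) τ

end

/-! Both target conditions come from the Fourier expansions of `φ|γ` for `γ` in `SL₂(ℤ)`. `D₀` and
`D₂` carry the Jacobi action of weight `k` to the slash actions of weights `k` and `k + 2`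
(`jacobiD2_jacobiSlash`), so modularity is inherited and each cusp reduces to `i∞`. There `4mn ≥
Mr²` forces `n ≥ 0`, which bounds `D₀`; if `n = 0` then `r = 0`, and `D₂` multiplies such a
coefficient by zero, so it vanishes at every cusp (`coeffD2_eq_zero`).

For injectivity, `D₀ φ = 0` removes the `τ`-derivative from `D₂ φ = 0`. As `k ≠ 0`, both `φ` and its
second `z`-derivative vanish at `z = 0`. With only `h₀` and `h_m` present, this is a homogeneous 2×2
system at each `τ`. On the imaginary axis its determinant is, up to a nonzero factor, a real
expression in theta moments, positive for large height (`eventually_thetaMoment_det_pos`). So `φ(·,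
z)` vanishes high on that axis, and the identity theorem gives `φ = 0`. -/

open scoped Manifold ModularForm

/-! ### Absolutely convergent exponential sums with real frequencies -/

section ExponentialSums

variable {ι : Type*} {a : ι → ℂ} {x : ι → ℝ} {s : Set ℝ}

lemma norm_cexp_freq (t : ℝ) (z : ℂ) :
    ‖Complex.exp (2 * Real.pi * Complex.I * t * z)‖ = Real.exp (-2 * Real.pi * t * z.im) := by
  rw [Complex.norm_exp]
  congr 1
  simp

/-- The exponential is monotone in `y`, in a direction set by the sign of `t`. The two edges of a
strip therefore dominate its interior for all frequencies at once. -/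
lemma exp_freq_le_add (t : ℝ) {y y₁ y₂ : ℝ} (h₁ : y₁ ≤ y) (h₂ : y ≤ y₂) :
    Real.exp (-2 * Real.pi * t * y) ≤
      Real.exp (-2 * Real.pi * t * y₁) + Real.exp (-2 * Real.pi * t * y₂) := by
  rcases le_total 0 t with ht | ht
  · refine le_add_of_le_of_nonneg (Real.exp_le_exp.2 ?_) (Real.exp_pos _).le
    have := mul_le_mul_of_nonneg_left h₁ (mul_nonneg Real.pi_pos.le ht)
    linarith
  · refine le_add_of_nonneg_of_le (Real.exp_pos _).le (Real.exp_le_exp.2 ?_)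
    have := mul_le_mul_of_nonneg_left h₂ (mul_nonneg Real.pi_pos.le (neg_nonneg.2 ht))
    linarith

/-- Around every point of an open set of reals there is a symmetric closed interval in the set. -/
lemma exists_pos_sub_add_mem (hs : IsOpen s) {y : ℝ} (hy : y ∈ s) :
    ∃ ε > 0, y - ε ∈ s ∧ y + ε ∈ s := by
  obtain ⟨ε, hε, h⟩ := Metric.isOpen_iff.1 hs y hy
  refine ⟨ε / 2, by positivity, h ?_, h ?_⟩ <;>
    simp [abs_of_pos, hε]

/-- A factor of the frequency costs only a small shift of the height: `|u| ≤ e^u + e^(-u)` with `u =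
2πxε` bounds the new term by those at `y ± ε`. -/
lemma summable_norm_mul_freq (hs : IsOpen s)
    (h : ∀ y ∈ s, Summable fun i => ‖a i‖ * Real.exp (-2 * Real.pi * x i * y)) :
    ∀ y ∈ s, Summable fun i => ‖a i * (2 * Real.pi * Complex.I * x i)‖ *
      Real.exp (-2 * Real.pi * x i * y) := by
  intro y hy
  obtain ⟨ε, hε, h₁, h₂⟩ := exists_pos_sub_add_mem hs hy
  refine Summable.of_nonneg_of_le (fun i => by positivity) (fun i => ?_)
    (((h _ h₁).add (h _ h₂)).mul_left ε⁻¹)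
  have key : ‖(2 * Real.pi * Complex.I * x i : ℂ)‖ * ε * Real.exp (-2 * Real.pi * x i * y) ≤
      Real.exp (-2 * Real.pi * x i * (y - ε)) + Real.exp (-2 * Real.pi * x i * (y + ε)) := by
    have hn : ‖(2 * Real.pi * Complex.I * x i : ℂ)‖ = 2 * Real.pi * |x i| := by
      simp [abs_of_pos Real.pi_pos]
    set u := 2 * Real.pi * x i * ε with hu
    have e₁ : Real.exp (-2 * Real.pi * x i * (y - ε)) =
        Real.exp u * Real.exp (-2 * Real.pi * x i * y) := by
      rw [← Real.exp_add]; congr 1; rw [hu]; ring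
    have e₂ : Real.exp (-2 * Real.pi * x i * (y + ε)) =
        Real.exp (-u) * Real.exp (-2 * Real.pi * x i * y) := by
      rw [← Real.exp_add]; congr 1; rw [hu]; ring
    rw [hn, e₁, e₂, ← add_mul]
    refine mul_le_mul_of_nonneg_right ?_ (Real.exp_pos _).le
    have : 2 * Real.pi * |x i| * ε = |u| := by
      rw [hu, abs_mul, abs_mul, abs_of_pos hε, abs_of_pos Real.two_pi_pos]
    rw [this]
    have p₁ := Real.exp_pos u
    have p₂ := Real.exp_pos (-u)
    have q₁ := Real.add_one_le_exp u
    have q₂ := Real.add_one_le_exp (-u)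
    rcases abs_cases u with ⟨hc, -⟩ | ⟨hc, -⟩ <;> rw [hc] <;> linarith
  rw [norm_mul]
  calc _ = ε⁻¹ * (‖a i‖ * (‖(2 * Real.pi * Complex.I * x i : ℂ)‖ * ε *
        Real.exp (-2 * Real.pi * x i * y))) := by field_simp
    _ ≤ ε⁻¹ * (‖a i‖ * (Real.exp (-2 * Real.pi * x i * (y - ε)) +
        Real.exp (-2 * Real.pi * x i * (y + ε)))) := by gcongr
    _ = _ := by ring

/-- An exponential sum which converges absolutely on an open union of horizontal strips may be
differentiated termwise. -/
lemma hasDerivAt_tsum_cexp (hs : IsOpen s)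
    (h : ∀ y ∈ s, Summable fun i => ‖a i‖ * Real.exp (-2 * Real.pi * x i * y))
    {z : ℂ} (hz : z.im ∈ s) :
    HasDerivAt (fun w => ∑' i, a i * Complex.exp (2 * Real.pi * Complex.I * x i * w))
      (∑' i, a i * (2 * Real.pi * Complex.I * x i) *
        Complex.exp (2 * Real.pi * Complex.I * x i * z)) z := by
  obtain ⟨ε, hε, h₁, h₂⟩ := exists_pos_sub_add_mem hs hz
  set U : Set ℂ := {w | z.im - ε < w.im ∧ w.im < z.im + ε} with hU
  have hUo : IsOpen U := (isOpen_lt continuous_const Complex.continuous_im).inter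
    (isOpen_lt Complex.continuous_im continuous_const)
  have hzU : z ∈ U := ⟨by linarith, by linarith⟩
  have hd (i : ι) (w : ℂ) :
      HasDerivAt (fun w => a i * Complex.exp (2 * Real.pi * Complex.I * x i * w))
        (a i * (2 * Real.pi * Complex.I * x i) *
          Complex.exp (2 * Real.pi * Complex.I * x i * w)) w := by
    have := (((hasDerivAt_id w).const_mul (2 * Real.pi * Complex.I * x i : ℂ)).cexp).const_mul (a i)
    refine this.congr_deriv ?_
    simp only [id]
    ring
  have hb (i : ι) (w : ℂ) (hw : w ∈ U) :
      ‖a i * Complex.exp (2 * Real.pi * Complex.I * x i * w)‖ ≤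
      ‖a i‖ * Real.exp (-2 * Real.pi * x i * (z.im - ε)) +
        ‖a i‖ * Real.exp (-2 * Real.pi * x i * (z.im + ε)) := by
    rw [norm_mul, norm_cexp_freq, ← mul_add]
    exact mul_le_mul_of_nonneg_left (exp_freq_le_add _ hw.1.le hw.2.le) (norm_nonneg _)
  have hdo (i : ι) : DifferentiableOn ℂ
      (fun w => a i * Complex.exp (2 * Real.pi * Complex.I * x i * w)) U :=
    fun w _ => (hd i w).differentiableAt.differentiableWithinAt
  have hsum := (h _ h₁).add (h _ h₂)
  have H := Complex.hasSum_deriv_of_summable_norm hsum hdo hUo hb hzU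
  simp_rw [fun i => (hd i z).deriv] at H
  rw [H.tsum_eq]
  exact ((Complex.differentiableOn_tsum_of_summable_norm hsum hdo hUo hb).differentiableAt
    (hUo.mem_nhds hzU)).hasDerivAt

lemma summable_cexp_freq
    {z : ℂ} (h : Summable fun i => ‖a i‖ * Real.exp (-2 * Real.pi * x i * z.im)) :
    Summable fun i => a i * Complex.exp (2 * Real.pi * Complex.I * x i * z) :=
  Summable.of_norm (by simpa only [norm_mul, norm_cexp_freq] using h)

lemma iteratedDeriv_two_tsum_cexp
    (h : ∀ y, Summable fun i => ‖a i‖ * Real.exp (-2 * Real.pi * x i * y)) (z : ℂ) :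
    iteratedDeriv 2
      (fun w => ∑' i, a i * Complex.exp (2 * Real.pi * Complex.I * x i * w)) z =
      ∑' i, a i * (2 * Real.pi * Complex.I * x i) ^ 2 *
        Complex.exp (2 * Real.pi * Complex.I * x i * z) := by
  rw [iteratedDeriv_succ, iteratedDeriv_one]
  have h1 : deriv (fun w => ∑' i, a i * Complex.exp (2 * Real.pi * Complex.I * x i * w)) =
      fun w => ∑' i, a i * (2 * Real.pi * Complex.I * x i) *
        Complex.exp (2 * Real.pi * Complex.I * x i * w) :=
    funext fun w => (hasDerivAt_tsum_cexp isOpen_univ (fun y _ => h y) (Set.mem_univ _)).deriv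
  rw [h1, (hasDerivAt_tsum_cexp isOpen_univ
    (summable_norm_mul_freq isOpen_univ (fun y _ => h y)) (Set.mem_univ _)).deriv]
  exact tsum_congr fun i => by ring

/-- An exponential sum with nonnegative frequencies which converges absolutely on the upper half
plane is bounded at `i∞`. -/
lemma isBoundedAtImInfty_tsum_cexp
    (h : ∀ y > 0, Summable fun i => ‖a i‖ * Real.exp (-2 * Real.pi * x i * y))
    (h0 : ∀ i, x i < 0 → a i = 0) :
    IsBoundedAtImInfty fun τ : ℍ =>
      ∑' i, a i * Complex.exp (2 * Real.pi * Complex.I * x i * τ) := by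
  rw [isBoundedAtImInfty_iff]
  refine ⟨∑' i, ‖a i‖ * Real.exp (-2 * Real.pi * x i * 1), 1, fun τ hτ => ?_⟩
  refine tsum_of_norm_bounded (h 1 one_pos).hasSum fun i => ?_
  rw [norm_mul, norm_cexp_freq]
  rcases lt_or_ge (x i) 0 with hi | hi
  · simp [h0 i hi]
  · refine mul_le_mul_of_nonneg_left (Real.exp_le_exp.2 ?_) (norm_nonneg _)
    have := mul_le_mul_of_nonneg_left hτ (mul_nonneg Real.pi_pos.le hi)
    simp only [coe_im]
    linarith

/-- An exponential sum with positive frequencies which converges absolutely on the upper half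
plane vanishes at `i∞`. -/
lemma isZeroAtImInfty_tsum_cexp
    (h : ∀ y > 0, Summable fun i => ‖a i‖ * Real.exp (-2 * Real.pi * x i * y))
    (h0 : ∀ i, x i ≤ 0 → a i = 0) :
    IsZeroAtImInfty fun τ : ℍ =>
      ∑' i, a i * Complex.exp (2 * Real.pi * Complex.I * x i * τ) := by
  have him : Filter.Tendsto UpperHalfPlane.im atImInfty Filter.atTop := Filter.tendsto_comap
  have := tendsto_tsum_of_dominated_convergence (𝓕 := atImInfty)
    (f := fun (τ : ℍ) i => a i * Complex.exp (2 * Real.pi * Complex.I * x i * τ))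
    (g := fun _ => 0) (h 1 one_pos) (fun i => ?_) ?_
  · simpa [IsZeroAtImInfty, Filter.ZeroAtFilter] using this
  · rcases le_or_gt (x i) 0 with hi | hi
    · simp [h0 i hi]
    · rw [tendsto_zero_iff_norm_tendsto_zero]
      simp only [norm_mul, norm_cexp_freq, coe_im]
      rw [← mul_zero ‖a i‖]
      refine (Real.tendsto_exp_atBot.comp ?_).const_mul _
      refine him.const_mul_atTop_of_neg ?_
      have := mul_pos Real.pi_pos hi
      linarith
  · filter_upwards [him.eventually_ge_atTop 1] with τ hτ i
    rw [norm_mul, norm_cexp_freq]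
    rcases lt_or_ge (x i) 0 with hi | hi
    · simp [h0 i hi.le]
    · refine mul_le_mul_of_nonneg_left (Real.exp_le_exp.2 ?_) (norm_nonneg _)
      have := mul_le_mul_of_nonneg_left hτ (mul_nonneg Real.pi_pos.le hi)
      simp only [coe_im]
      linarith

end ExponentialSums

/-- `ψ` has a Fourier expansion `∑ c(n, r) e^(2πi (n/M) τ) e^(2πi r z)` supported on the pairs
`(n, r)` with `4m(n/M) ≥ r²`. -/
structure HasJacobiExpansion (m M : ℕ) (ψ : ℍ → ℂ → ℂ) (c : ℤ × ℤ → ℂ) : Prop where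
  support : ∀ n r : ℤ, 4 * m * n < M * r ^ 2 → c (n, r) = 0
  hasSum : ∀ (τ : ℍ) (z : ℂ), HasSum
      (fun p : ℤ × ℤ => c p *
        Complex.exp (2 * Real.pi * Complex.I * ((p.1 : ℂ) / M * τ + p.2 * z))) (ψ τ z)

/-! ### Behaviour of `D₀` and `D₂` on Fourier expansions -/

namespace HasJacobiExpansion

variable {m M : ℕ} {ψ : ℍ → ℂ → ℂ} {c : ℤ × ℤ → ℂ}

lemma cexp_split (p : ℤ × ℤ) (w z : ℂ) :
    Complex.exp (2 * Real.pi * Complex.I * ((p.1 : ℂ) / M * w + p.2 * z)) =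
      Complex.exp (2 * Real.pi * Complex.I * ((p.1 / M : ℝ) : ℂ) * w) *
        Complex.exp (2 * Real.pi * Complex.I * ((p.2 : ℝ) : ℂ) * z) := by
  rw [← Complex.exp_add]
  congr 1
  push_cast
  ring

lemma summable_norm (h : HasJacobiExpansion m M ψ c) {y : ℝ} (hy : 0 < y) (v : ℝ) :
    Summable fun p => ‖c p‖ * Real.exp (-2 * Real.pi * (p.1 / M : ℝ) * y) *
      Real.exp (-2 * Real.pi * (p.2 : ℝ) * v) := by
  -- At `τ = iy`, `z = iv` the summands have exactly the required norms.
  have := (h.hasSum ⟨Complex.I * y, by simpa using hy⟩ (Complex.I * v)).summable.norm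
  simp only [cexp_split, norm_mul, norm_cexp_freq] at this
  simpa [mul_assoc] using this

lemma iteratedDeriv_two (h : HasJacobiExpansion m M ψ c) (τ : ℍ) :
    iteratedDeriv 2 (ψ τ) 0 = ∑' p : ℤ × ℤ, c p * (2 * Real.pi * Complex.I * (p.2 : ℝ)) ^ 2 *
      Complex.exp (2 * Real.pi * Complex.I * ((p.1 / M : ℝ) : ℂ) * τ) := by
  have e : ψ τ = fun z => ∑' p : ℤ × ℤ,
      c p * Complex.exp (2 * Real.pi * Complex.I * ((p.1 / M : ℝ) : ℂ) * τ) *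
        Complex.exp (2 * Real.pi * Complex.I * ((p.2 : ℝ) : ℂ) * z) := by
    funext z
    rw [← (h.hasSum τ z).tsum_eq]
    exact tsum_congr fun p => by rw [cexp_split, ← mul_assoc]
  rw [e, iteratedDeriv_two_tsum_cexp]
  · exact tsum_congr fun p => by rw [mul_zero, Complex.exp_zero]; ring
  · intro v
    simp only [norm_mul, norm_cexp_freq]
    exact h.summable_norm τ.im_pos v

lemma apply_zero (h : HasJacobiExpansion m M ψ c) (τ : ℍ) :
    ψ τ 0 = ∑' p : ℤ × ℤ, c p *
      Complex.exp (2 * Real.pi * Complex.I * ((p.1 / M : ℝ) : ℂ) * τ) := by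
  rw [← (h.hasSum τ 0).tsum_eq]
  exact tsum_congr fun p => by rw [cexp_split, mul_zero, Complex.exp_zero, mul_one]

lemma summable_norm_zero (h : HasJacobiExpansion m M ψ c) : ∀ y ∈ Set.Ioi (0 : ℝ),
    Summable fun p => ‖c p‖ * Real.exp (-2 * Real.pi * (p.1 / M : ℝ) * y) := fun y hy => by
  simpa using h.summable_norm hy 0

lemma hasDerivAt_ofComplex (h : HasJacobiExpansion m M ψ c) (τ : ℍ) :
    HasDerivAt (fun w : ℂ => ψ (ofComplex w) 0)
      (∑' p : ℤ × ℤ, c p * (2 * Real.pi * Complex.I * ((p.1 / M : ℝ) : ℂ)) *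
        Complex.exp (2 * Real.pi * Complex.I * ((p.1 / M : ℝ) : ℂ) * τ)) τ := by
  refine (hasDerivAt_tsum_cexp isOpen_Ioi h.summable_norm_zero τ.im_pos).congr_of_eventuallyEq ?_
  filter_upwards [isOpen_upperHalfPlaneSet.mem_nhds τ.im_pos] with w hw
  rw [h.apply_zero, ofComplex_apply_of_im_pos hw]

/-- The coefficients of the expansion of `D₂ ψ`. -/
noncomputable def coeffD2 (k : ℤ) (m M : ℕ) (c : ℤ × ℤ → ℂ) (p : ℤ × ℤ) : ℂ :=
  k / (2 * Real.pi * Complex.I) * (c p * (2 * Real.pi * Complex.I * (p.2 : ℝ)) ^ 2) -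
    2 * m * (c p * (2 * Real.pi * Complex.I * ((p.1 / M : ℝ) : ℂ)))

/-- For fixed height `y` this is an exponential sum in `z`, convergent at every `v`. Two
applications of `summable_norm_mul_freq` at `v = 0` supply the square of the frequency `r`. -/
lemma summable_norm_sq_freq (h : HasJacobiExpansion m M ψ c) {y : ℝ} (hy : 0 < y) :
    Summable fun p : ℤ × ℤ => ‖c p * (2 * Real.pi * Complex.I * (p.2 : ℝ)) ^ 2‖ *
      Real.exp (-2 * Real.pi * (p.1 / M : ℝ) * y) := by
  have := summable_norm_mul_freq (s := Set.univ) isOpen_univ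
    (summable_norm_mul_freq (s := Set.univ) isOpen_univ
      (a := fun p => c p * Real.exp (-2 * Real.pi * (p.1 / M : ℝ) * y))
      (x := fun p : ℤ × ℤ => (p.2 : ℝ)) (fun v _ => ?_)) 0 (Set.mem_univ _)
  · refine this.congr fun p => ?_
    rw [mul_zero, Real.exp_zero, mul_one, ← Real.norm_of_nonneg (Real.exp_pos
      (-2 * Real.pi * (p.1 / M : ℝ) * y)).le, ← Complex.norm_real, ← norm_mul]
    congr 1
    rw [Complex.norm_real, Real.norm_of_nonneg (Real.exp_pos _).le]
    ring
  · refine (h.summable_norm hy v).congr fun p => ?_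
    rw [norm_mul, Complex.norm_real, Real.norm_of_nonneg (Real.exp_pos _).le]

lemma summable_norm_coeffD2 (h : HasJacobiExpansion m M ψ c) (k : ℤ) : ∀ y ∈ Set.Ioi (0 : ℝ),
    Summable fun p => ‖coeffD2 k m M c p‖ * Real.exp (-2 * Real.pi * (p.1 / M : ℝ) * y) := by
  intro y hy
  refine Summable.of_nonneg_of_le (fun i => by positivity) (fun p => ?_)
    (((h.summable_norm_sq_freq hy).mul_left ‖(k / (2 * Real.pi * Complex.I) : ℂ)‖).add
      ((summable_norm_mul_freq isOpen_Ioi h.summable_norm_zero y hy).mul_left ‖(2 * m : ℂ)‖))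
  rw [← mul_assoc, ← mul_assoc, ← add_mul, ← norm_mul, ← norm_mul]
  exact mul_le_mul_of_nonneg_right (norm_sub_le _ _) (Real.exp_pos _).le

lemma jacobiD2_eq (h : HasJacobiExpansion m M ψ c) (k : ℤ) (τ : ℍ) :
    jacobiD2 k m ψ τ = ∑' p : ℤ × ℤ, coeffD2 k m M c p *
      Complex.exp (2 * Real.pi * Complex.I * ((p.1 / M : ℝ) : ℂ) * τ) := by
  have s₁ := summable_cexp_freq (z := (τ : ℂ)) (h.summable_norm_sq_freq τ.im_pos)
  have s₂ := summable_cexp_freq (z := (τ : ℂ))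
    (summable_norm_mul_freq isOpen_Ioi h.summable_norm_zero τ.im τ.im_pos)
  rw [jacobiD2, h.iteratedDeriv_two, (h.hasDerivAt_ofComplex τ).deriv, ← tsum_mul_left,
    ← tsum_mul_left, ← (s₁.mul_left _).tsum_sub (s₂.mul_left _)]
  exact tsum_congr fun p => by rw [coeffD2]; ring

lemma mdifferentiable_tsum {b : ℤ × ℤ → ℂ} {x : ℤ × ℤ → ℝ}
    (hb : ∀ y ∈ Set.Ioi (0 : ℝ), Summable fun p => ‖b p‖ * Real.exp (-2 * Real.pi * x p * y)) :
    MDiff fun τ : ℍ => ∑' p, b p * Complex.exp (2 * Real.pi * Complex.I * x p * τ) := by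
  rw [UpperHalfPlane.mdifferentiable_iff]
  refine DifferentiableOn.congr (f := fun w : ℂ =>
    ∑' p, b p * Complex.exp (2 * Real.pi * Complex.I * x p * w)) (fun w hw => ?_) fun w hw => ?_
  · exact (hasDerivAt_tsum_cexp isOpen_Ioi hb hw).differentiableAt.differentiableWithinAt
  · simp only [Function.comp_apply, ofComplex_apply_of_im_pos hw]

lemma coeff_eq_zero (h : HasJacobiExpansion m M ψ c) (hM : 0 < M) {p : ℤ × ℤ}
    (hp : (p.1 / M : ℝ) < 0) (hm : 0 < m) : c p = 0 := by
  have hn : p.1 < 0 := by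
    rw [div_neg_iff] at hp
    have : (0 : ℝ) < M := by exact_mod_cast hM
    rcases hp with hp | hp
    · linarith
    · exact_mod_cast hp.1
  refine h.support p.1 p.2 (lt_of_lt_of_le ?_ (by positivity : (0 : ℤ) ≤ M * p.2 ^ 2))
  have : (0 : ℤ) < 4 * m := by positivity
  nlinarith

/-- This is the source of cuspidality: for `n = 0` the support condition leaves only `r = 0`, and
each term of the coefficient contains `r` or `n`. -/
lemma coeffD2_eq_zero (h : HasJacobiExpansion m M ψ c) (k : ℤ) (hM : 0 < M) {p : ℤ × ℤ}
    (hp : (p.1 / M : ℝ) ≤ 0) (hm : 0 < m) : coeffD2 k m M c p = 0 := by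
  rcases hp.lt_or_eq with hp | hp
  · simp [coeffD2, h.coeff_eq_zero hM hp hm]
  · have hn : p.1 = 0 := by
      have hM' : (M : ℝ) ≠ 0 := by exact_mod_cast hM.ne'
      exact_mod_cast (div_eq_zero_iff.1 hp).resolve_right hM'
    by_cases hr : p.2 = 0
    · simp [coeffD2, hn, hr]
    · have : c p = 0 := by
        refine h.support p.1 p.2 ?_
        rw [hn, mul_zero]
        positivity
      simp [coeffD2, this]

lemma mdifferentiable_jacobiD0 (h : HasJacobiExpansion m M ψ c) : MDiff (jacobiD0 ψ) := by
  rw [show jacobiD0 ψ = _ from funext h.apply_zero]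
  exact mdifferentiable_tsum h.summable_norm_zero

lemma mdifferentiable_jacobiD2 (h : HasJacobiExpansion m M ψ c) (k : ℤ) :
    MDiff (jacobiD2 k m ψ) := by
  rw [show jacobiD2 k m ψ = _ from funext (h.jacobiD2_eq k)]
  exact mdifferentiable_tsum (h.summable_norm_coeffD2 k)

lemma isBoundedAtImInfty_jacobiD0 (h : HasJacobiExpansion m M ψ c) (hm : 0 < m) (hM : 0 < M) :
    IsBoundedAtImInfty (jacobiD0 ψ) := by
  rw [show jacobiD0 ψ = _ from funext h.apply_zero]
  exact isBoundedAtImInfty_tsum_cexp h.summable_norm_zero fun p hp => h.coeff_eq_zero hM hp hm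

lemma isZeroAtImInfty_jacobiD2 (h : HasJacobiExpansion m M ψ c) (k : ℤ) (hm : 0 < m)
    (hM : 0 < M) : IsZeroAtImInfty (jacobiD2 k m ψ) := by
  rw [show jacobiD2 k m ψ = _ from funext (h.jacobiD2_eq k)]
  exact isZeroAtImInfty_tsum_cexp (h.summable_norm_coeffD2 k)
    fun p hp => h.coeffD2_eq_zero k hM hp hm

end HasJacobiExpansion

/-! ### Compatibility of `D₀` and `D₂` with the slash actions -/

section Slash

/-- The Gaussian factor is even, so no first-order cross term survives at `0`. Its contribution `-2A
g(0)` is the defect that the `τ`-derivative must cancel. -/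
lemma iteratedDeriv_two_exp_mul_comp {g : ℂ → ℂ} (hg : Differentiable ℂ g) (A D : ℂ) :
    iteratedDeriv 2 (fun z => Complex.exp (-(A * z ^ 2)) * g (z / D)) 0 =
      -(2 * A) * g 0 + iteratedDeriv 2 g 0 / D ^ 2 := by
  have he (z : ℂ) : HasDerivAt (fun z => Complex.exp (-(A * z ^ 2)))
      (Complex.exp (-(A * z ^ 2)) * -(A * (2 * z))) z := by
    simpa using (((hasDerivAt_id z).pow 2).const_mul A).neg.cexp
  have hc {f : ℂ → ℂ} (hf : Differentiable ℂ f) (z : ℂ) :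
      HasDerivAt (fun z => f (z / D)) (deriv f (z / D) / D) z := by
    simpa [div_eq_mul_inv, Function.comp_def] using
      (hf (z / D)).hasDerivAt.comp z ((hasDerivAt_id z).div_const D)
  have hg' : Differentiable ℂ (deriv g) := fun z => (hg.analyticAt z).deriv.differentiableAt
  have h1 : deriv (fun z => Complex.exp (-(A * z ^ 2)) * g (z / D)) = fun z =>
      Complex.exp (-(A * z ^ 2)) * -(A * (2 * z)) * g (z / D) +
        Complex.exp (-(A * z ^ 2)) * (deriv g (z / D) / D) :=
    funext fun z => ((he z).mul (hc hg z)).deriv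
  rw [iteratedDeriv_succ, iteratedDeriv_one, iteratedDeriv_succ, iteratedDeriv_one, h1]
  have hl : HasDerivAt (fun z : ℂ => -(A * (2 * z))) (-(A * 2)) 0 := by
    simpa using (((hasDerivAt_id (0 : ℂ)).const_mul 2).const_mul A).fun_neg
  refine ((((he 0).mul hl).mul (hc hg 0)).add
    ((he 0).mul ((hc hg' 0).div_const D))).deriv.trans ?_
  simp
  ring

/-- A function holomorphic on `ℍ × ℂ` is entire in the second variable. -/
lemma IsJacobiForm.differentiable_right {k : ℤ} {m M : ℕ} {φ : ℍ → ℂ → ℂ}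
    (h : IsJacobiForm k m M φ) (τ : ℍ) : Differentiable ℂ (φ τ) := by
  intro z
  have ho : IsOpen {p : ℂ × ℂ | 0 < p.1.im} :=
    isOpen_lt continuous_const (Complex.continuous_im.comp continuous_fst)
  have := (h.holo.differentiableAt (ho.mem_nhds (x := ((τ : ℂ), z)) τ.im_pos)).comp z
    ((differentiableAt_const (τ : ℂ)).prodMk differentiableAt_id)
  simpa [Function.comp_def] using this

lemma IsJacobiForm.differentiableAt_left {k : ℤ} {m M : ℕ} {φ : ℍ → ℂ → ℂ}
    (h : IsJacobiForm k m M φ) (z : ℂ) {w : ℂ} (hw : 0 < w.im) :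
    DifferentiableAt ℂ (fun w => φ (ofComplex w) z) w := by
  have ho : IsOpen {p : ℂ × ℂ | 0 < p.1.im} :=
    isOpen_lt continuous_const (Complex.continuous_im.comp continuous_fst)
  exact DifferentiableAt.comp (f := fun w : ℂ => (w, z)) w
    (h.holo.differentiableAt (ho.mem_nhds (x := (w, z)) hw))
    (differentiableAt_fun_id.prodMk (differentiableAt_const z))

lemma jacobiD0_jacobiSlash (k : ℤ) (m : ℕ) (γ : SL(2, ℤ)) (φ : ℍ → ℂ → ℂ) :
    jacobiD0 (jacobiSlash k m γ φ) = jacobiD0 φ ∣[k] γ := by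
  funext τ
  simp [jacobiD0, jacobiSlash, ModularForm.SL_slash_apply, mul_comm]

/-- The operator `D₂` intertwines the Jacobi action of weight `k` with the action of weight
`k + 2` on modular forms. -/
lemma jacobiD2_jacobiSlash {k : ℤ} {m M : ℕ} {φ : ℍ → ℂ → ℂ} (h : IsJacobiForm k m M φ)
    (γ : SL(2, ℤ)) : jacobiD2 k m (jacobiSlash k m γ φ) = jacobiD2 k m φ ∣[k + 2] γ := by
  funext τ
  have hD : denom γ τ ≠ 0 := denom_ne_zero _ τ
  set D := denom γ τ with hDdef
  set c : ℂ := ((γ 1 0 : ℤ) : ℂ) with hc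
  have hz : iteratedDeriv 2 (fun z => jacobiSlash k m γ φ τ z) 0 =
      D ^ (-k) * (-(2 * (2 * Real.pi * Complex.I * m * c / D)) * φ (γ • τ) 0 +
        iteratedDeriv 2 (φ (γ • τ)) 0 / D ^ 2) := by
    rw [← iteratedDeriv_two_exp_mul_comp (h.differentiable_right _), ← iteratedDeriv_const_mul_field]
    congr 1
    funext z
    simp only [jacobiSlash, ← hDdef, ← hc, mul_assoc]
    congr 4
    ring
  have hdet1 : (γ : GL (Fin 2) ℝ).val.det = 1 :=
    (Matrix.SpecialLinearGroup.map (Int.castRingHom ℝ) γ).det_coe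
  have hsm : HasDerivAt (fun w : ℂ => ((γ • ofComplex w : ℍ) : ℂ)) (1 / D ^ 2) τ := by
    have := (hasStrictDerivAt_smul (hdet1 ▸ one_pos) τ).hasDerivAt
    rwa [hdet1, Complex.ofReal_one] at this
  have hφ : HasDerivAt (fun w : ℂ => φ (γ • ofComplex w) 0)
      (deriv (fun w : ℂ => φ (ofComplex w) 0) (γ • τ : ℍ) * (1 / D ^ 2)) τ := by
    have h1 := (h.differentiableAt_left 0 (γ • τ).im_pos).hasDerivAt
    have h2 : HasDerivAt (fun w => φ (ofComplex w) 0)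
        (deriv (fun w : ℂ => φ (ofComplex w) 0) (γ • τ : ℍ))
        ((γ • ofComplex (τ : ℂ) : ℍ) : ℂ) := by simpa using h1
    simpa [Function.comp_def] using h2.comp (τ : ℂ) hsm
  have hτ : deriv (fun w : ℂ => jacobiSlash k m γ φ (ofComplex w) 0) τ =
      ((-k : ℤ) : ℂ) * c * D ^ (-k - 1) * φ (γ • τ) 0 +
        D ^ (-k) * (deriv (fun w : ℂ => φ (ofComplex w) 0) (γ • τ : ℍ) * (1 / D ^ 2)) := by
    have := (hasDerivAt_denom_zpow (γ : GL (Fin 2) ℝ) (-k) τ).mul hφ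
    have e : (fun w : ℂ => jacobiSlash k m γ φ (ofComplex w) 0) =ᶠ[nhds (τ : ℂ)]
        fun w => denom γ w ^ (-k) * φ (γ • ofComplex w) 0 := by
      filter_upwards [isOpen_upperHalfPlaneSet.mem_nhds τ.im_pos] with w hw
      simp [jacobiSlash, ofComplex_apply_of_im_pos hw]
    rw [e.deriv_eq]
    refine this.deriv.trans ?_
    simp [hc, hDdef]
  -- The Gaussian contributes `-2kmc D^(-k-1) φ(γτ, 0)`, and differentiating `D^(-k)` contributes
  -- the opposite. The surviving terms both carry `D^(-k-2)`.
  rw [ModularForm.SL_slash_apply, jacobiD2, hz, hτ, jacobiD2, ← hDdef,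
    show -(k + 2) = -k - 2 by ring, zpow_sub₀ hD, zpow_sub₀ hD]
  have hpi : (Real.pi : ℂ) ≠ 0 := by exact_mod_cast Real.pi_ne_zero
  have hI := Complex.I_ne_zero
  push_cast
  simp only [zpow_one]
  rw [show D ^ (2 : ℤ) = D ^ 2 from by norm_cast]
  field_simp
  ring

end Slash

/-! ### Theta constants on the imaginary axis -/

section Theta

/-- The summands of `θ^J_{m,r}(τ, z)`, as an exponential sum in `z`. -/
lemma thetaJ_eq_tsum (m r : ℕ) (τ : ℍ) (z : ℂ) :
    thetaJ m r τ z = ∑' n : ℤ,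
      Complex.exp (2 * Real.pi * Complex.I * ((m * (n + r / (2 * m)) ^ 2 : ℝ) : ℂ) * τ) *
        Complex.exp (2 * Real.pi * Complex.I * ((2 * m * (n + r / (2 * m)) : ℝ) : ℂ) * z) := by
  refine tsum_congr fun n => ?_
  rw [← Complex.exp_add]
  congr 1
  push_cast
  ring

lemma summable_thetaJ {m : ℕ} (hm : 0 < m) (r : ℕ) {y : ℝ} (hy : 0 < y) (v : ℝ) :
    Summable fun n : ℤ => Real.exp (-2 * Real.pi * (m * (n + r / (2 * m)) ^ 2 : ℝ) * y) *
      Real.exp (-2 * Real.pi * (2 * m * (n + r / (2 * m)) : ℝ) * v) := by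
  have hm' : (0 : ℝ) < m := by exact_mod_cast hm
  -- Expanding the square gives a two-variable Jacobi theta term with parameter `2imy` and argument
  -- `i(2mv + ry)`, up to a factor free of `n`.
  have := ((summable_jacobiTheta₂_term_iff (Complex.I * (2 * m * v + r * y : ℝ))
    (Complex.I * (2 * m * y : ℝ))).2 (by simpa using by positivity)).norm.mul_left
      (Real.exp (-2 * Real.pi * (m * (r / (2 * m)) ^ 2) * y) *
        Real.exp (-2 * Real.pi * (2 * m * (r / (2 * m))) * v))
  refine this.congr fun n => ?_
  rw [norm_jacobiTheta₂_term, ← Real.exp_add, ← Real.exp_add, ← Real.exp_add]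
  congr 1
  simp only [Complex.I_mul_im, Complex.ofReal_re]
  field_simp
  ring

/-- The theta constant `∑ a^(2j) e^(-2πma²y)` over `a ∈ ℤ + r/2m`. -/
noncomputable def thetaMoment (m r j : ℕ) (y : ℝ) : ℝ :=
  ∑' n : ℤ, (n + r / (2 * m) : ℝ) ^ (2 * j) *
    Real.exp (-2 * Real.pi * (m * (n + r / (2 * m)) ^ 2 : ℝ) * y)

lemma summable_thetaMoment_zero {m : ℕ} (hm : 0 < m) (r : ℕ) {y : ℝ} (hy : 0 < y) :
    Summable fun n : ℤ => (n + r / (2 * m) : ℝ) ^ (2 * 0) *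
      Real.exp (-2 * Real.pi * (m * (n + r / (2 * m)) ^ 2 : ℝ) * y) := by
  simpa using summable_thetaJ hm r hy 0

lemma summable_thetaMoment_one {m : ℕ} (hm : 0 < m) (r : ℕ) {y : ℝ} (hy : 0 < y) :
    Summable fun n : ℤ => (n + r / (2 * m) : ℝ) ^ (2 * 1) *
      Real.exp (-2 * Real.pi * (m * (n + r / (2 * m)) ^ 2 : ℝ) * y) := by
  have hm' : (m : ℝ) ≠ 0 := by exact_mod_cast hm.ne'
  have := (summable_norm_mul_freq (s := Set.Ioi 0) isOpen_Ioi (a := fun _ : ℤ => 1)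
    (x := fun n : ℤ => m * (n + r / (2 * m) : ℝ) ^ 2)
    (fun y hy => by simpa using summable_thetaJ hm r hy 0) y hy).mul_left (2 * Real.pi * m)⁻¹
  refine this.congr fun n => ?_
  have : ‖(1 * (2 * Real.pi * Complex.I * ((m * (n + r / (2 * m) : ℝ) ^ 2 : ℝ) : ℂ)) : ℂ)‖ =
      2 * Real.pi * (m * (n + r / (2 * m) : ℝ) ^ 2) := by
    rw [one_mul, norm_mul, Complex.norm_real, Real.norm_of_nonneg (by positivity)]
    simp [abs_of_pos Real.pi_pos]
  rw [this, mul_one]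
  have := Real.pi_ne_zero
  field_simp

lemma thetaJ_zero_of_re_eq_zero (m r : ℕ) {τ : ℍ} (hτ : (τ : ℂ) = Complex.I * τ.im) :
    thetaJ m r τ 0 = thetaMoment m r 0 τ.im := by
  rw [thetaJ_eq_tsum, thetaMoment, Complex.ofReal_tsum]
  refine tsum_congr fun n => ?_
  rw [hτ, mul_zero, Complex.exp_zero, mul_one, mul_zero, pow_zero, one_mul, Complex.ofReal_exp]
  congr 1
  push_cast
  linear_combination (2 * Real.pi * (m * (n + r / (2 * m)) ^ 2 : ℂ) * τ.im) * Complex.I_sq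

lemma differentiable_thetaJ {m : ℕ} (hm : 0 < m) (r : ℕ) (τ : ℍ) :
    Differentiable ℂ (thetaJ m r τ) := by
  rw [show thetaJ m r τ = _ from funext (thetaJ_eq_tsum m r τ)]
  intro z
  refine (hasDerivAt_tsum_cexp isOpen_univ (fun v _ => ?_) (Set.mem_univ _)).differentiableAt
  simpa only [norm_cexp_freq, coe_im] using summable_thetaJ hm r τ.im_pos v

lemma iteratedDeriv_two_thetaJ {m : ℕ} (hm : 0 < m) (r : ℕ) {τ : ℍ}
    (hτ : (τ : ℂ) = Complex.I * τ.im) :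
    iteratedDeriv 2 (thetaJ m r τ) 0 =
      (4 * Real.pi * Complex.I * m) ^ 2 * thetaMoment m r 1 τ.im := by
  rw [show thetaJ m r τ = _ from funext (thetaJ_eq_tsum m r τ), iteratedDeriv_two_tsum_cexp,
    thetaMoment, Complex.ofReal_tsum, ← tsum_mul_left]
  · refine tsum_congr fun n => ?_
    rw [mul_zero, Complex.exp_zero, mul_one, Complex.ofReal_mul (_ ^ _), Complex.ofReal_exp]
    have : (2 * Real.pi * Complex.I * ((m * (n + r / (2 * m)) ^ 2 : ℝ) : ℂ) * τ) =
        ((-2 * Real.pi * (m * (n + r / (2 * m)) ^ 2 : ℝ) * τ.im : ℝ) : ℂ) := by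
      rw [hτ]
      push_cast
      linear_combination (2 * Real.pi * (m * (n + r / (2 * m)) ^ 2 : ℂ) * τ.im) * Complex.I_sq
    rw [this]
    push_cast
    ring
  · intro v
    simpa only [norm_cexp_freq, coe_im] using summable_thetaJ hm r τ.im_pos v

lemma one_le_thetaMoment_zero_zero {m : ℕ} (hm : 0 < m) {y : ℝ} (hy : 0 < y) :
    1 ≤ thetaMoment m 0 0 y := by
  have := (summable_thetaMoment_zero hm 0 hy).le_tsum 0 fun n _ => by rw [pow_mul]; positivity
  simpa [thetaMoment] using this

lemma thetaMoment_self_zero_pos {m : ℕ} (hm : 0 < m) {y : ℝ} (hy : 0 < y) :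
    0 < thetaMoment m m 0 y :=
  (summable_thetaMoment_zero hm m hy).tsum_pos (fun n => by rw [pow_mul]; positivity) 0
    (by simp [Real.exp_pos])

/-- For `r = m` the sum runs over half-integers `a`, for which `a² ≥ 1/4`. -/
lemma thetaMoment_self_zero_le {m : ℕ} (hm : 0 < m) {y : ℝ} (hy : 0 < y) :
    thetaMoment m m 0 y ≤ 4 * thetaMoment m m 1 y := by
  rw [thetaMoment, thetaMoment, ← tsum_mul_left]
  refine (summable_thetaMoment_zero hm m hy).tsum_le_tsum (fun n => ?_)
    ((summable_thetaMoment_one hm m hy).mul_left 4)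
  rw [← mul_assoc 4]
  refine mul_le_mul_of_nonneg_right ?_ (Real.exp_pos _).le
  have hm' : (m : ℝ) ≠ 0 := by exact_mod_cast hm.ne'
  have h : (m : ℝ) / (2 * m) = 1 / 2 := by field_simp
  rw [h]
  have : (0 : ℝ) ≤ n * (n + 1) := by
    have : 0 ≤ n * (n + 1) := by
      rcases le_or_gt 0 n with h | h
      · positivity
      · exact mul_nonneg_of_nonpos_of_nonpos h.le (by omega)
    exact_mod_cast this
  simp only [mul_zero, pow_zero, mul_one]
  nlinarith

/-- The factor `a²` removes the only non-decaying term, `n = 0`; the series at `y = 1` dominates the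
rest. -/
lemma tendsto_thetaMoment_zero_one {m : ℕ} (hm : 0 < m) :
    Filter.Tendsto (thetaMoment m 0 1) Filter.atTop (nhds 0) := by
  have := tendsto_tsum_of_dominated_convergence (𝓕 := Filter.atTop)
    (f := fun (y : ℝ) (n : ℤ) => (n + (0 : ℕ) / (2 * m) : ℝ) ^ (2 * 1) *
      Real.exp (-2 * Real.pi * (m * (n + (0 : ℕ) / (2 * m)) ^ 2 : ℝ) * y))
    (g := fun _ => 0) (summable_thetaMoment_one hm 0 one_pos) (fun n => ?_) ?_
  · rw [tsum_zero] at this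
    exact this
  · rcases eq_or_ne n 0 with rfl | hn
    · simp
    · rw [← mul_zero ((n + (0 : ℕ) / (2 * m) : ℝ) ^ (2 * 1))]
      refine (Real.tendsto_exp_atBot.comp ?_).const_mul _
      refine Filter.tendsto_id.const_mul_atTop_of_neg ?_
      have hn' : (n : ℝ) ≠ 0 := by exact_mod_cast hn
      have : 0 < Real.pi * (m * (n + (0 : ℕ) / (2 * m)) ^ 2 : ℝ) := by
        simp only [Nat.cast_zero, zero_div, add_zero]
        have := Real.pi_pos
        positivity
      linarith
  · filter_upwards [Filter.eventually_ge_atTop 1] with y hy n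
    rw [Real.norm_of_nonneg (by rw [pow_mul]; positivity)]
    refine mul_le_mul_of_nonneg_left (Real.exp_le_exp.2 ?_) (by rw [pow_mul]; positivity)
    have h0 : 0 ≤ Real.pi * (m * (n + (0 : ℕ) / (2 * m)) ^ 2 : ℝ) :=
      mul_nonneg Real.pi_pos.le (by positivity)
    have := mul_le_mul_of_nonneg_left hy h0
    linarith

/-- The Wronskian of the theta constants `θ_{m,0}(τ, 0)` and `θ_{m,m}(τ, 0)` does not vanish
high up on the imaginary axis. -/
lemma eventually_thetaMoment_det_pos {m : ℕ} (hm : 0 < m) : ∀ᶠ y in Filter.atTop,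
    0 < thetaMoment m 0 0 y * thetaMoment m m 1 y - thetaMoment m m 0 y * thetaMoment m 0 1 y := by
  filter_upwards [(tendsto_thetaMoment_zero_one hm).eventually_lt_const
    (by norm_num : (0 : ℝ) < 1 / 4), Filter.eventually_gt_atTop 0] with y h1 hy
  have h2 := one_le_thetaMoment_zero_zero hm hy
  have h3 := thetaMoment_self_zero_pos hm hy
  have h4 := thetaMoment_self_zero_le hm hy
  -- The first product is at least a quarter of `thetaMoment m m 0 y`, while the second is strictly
  -- less than that.
  nlinarith

end Theta

/-! ### Injectivity via the theta decomposition -/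

section Injectivity

variable {k : ℤ} {m M : ℕ} {φ : ℍ → ℂ → ℂ}

/-- A holomorphic function on `ℍ` which vanishes high up on the imaginary axis is zero. -/
lemma eq_zero_of_imaginary_axis {f : ℍ → ℂ} (hf : MDiff f) {Y : ℝ}
    (hY : ∀ y : ℝ, Y ≤ y → f (ofComplex (Complex.I * y)) = 0) : f = 0 := by
  have hY1 : 0 < max Y 0 + 1 := by positivity
  have hpos {y : ℝ} (hy : y ∈ Set.Ioi (max Y 0 + 1)) : 0 < (Complex.I * (y : ℂ)).im := by
    simpa using hY1.trans hy
  -- The axis points above `σ` accumulate at `σ`, as the identity theorem requires; the `max` and `+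
  -- 1` keep `σ` inside `ℍ`.
  obtain ⟨σ, hσ⟩ : ∃ σ : ℍ, (σ : ℂ) = Complex.I * (max Y 0 + 1 : ℝ) :=
    ⟨⟨Complex.I * (max Y 0 + 1 : ℝ), by simpa using hY1⟩, rfl⟩
  have ht : Filter.Tendsto (fun y : ℝ => ofComplex (Complex.I * y))
      (nhdsWithin (max Y 0 + 1) (Set.Ioi (max Y 0 + 1))) (nhdsWithin σ {σ}ᶜ) := by
    refine tendsto_nhdsWithin_iff.2 ⟨?_, ?_⟩
    · rw [isOpenEmbedding_coe.isInducing.tendsto_nhds_iff, hσ]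
      refine Filter.Tendsto.congr' (f₁ := fun y : ℝ => Complex.I * (y : ℂ)) ?_
        (((continuous_const.mul Complex.continuous_ofReal).tendsto _).mono_left nhdsWithin_le_nhds)
      filter_upwards [self_mem_nhdsWithin] with y hy
      simp [ofComplex_apply_of_im_pos (hpos hy)]
    · filter_upwards [self_mem_nhdsWithin] with y hy he
      have := congrArg UpperHalfPlane.coe (Set.mem_singleton_iff.1 he)
      rw [ofComplex_apply_of_im_pos (hpos hy), hσ] at this
      exact (Set.mem_Ioi.1 hy).ne' (by exact_mod_cast mul_left_cancel₀ Complex.I_ne_zero this)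
  refine eq_zero_of_frequently hf (ht.frequently (Filter.Eventually.frequently ?_))
  filter_upwards [self_mem_nhdsWithin] with y hy
  exact hY y (((le_max_left _ _).trans (by linarith)).trans (Set.mem_Ioi.1 hy).le)

lemma eq_zero_of_jacobiD0_eq_zero_of_jacobiD2_eq_zero (hk : k ≠ 0) (hm : 0 < m)
    (hφ : φ ∈ jacobiFormsStar k m M) (h0 : jacobiD0 φ = 0) (h2 : jacobiD2 k m φ = 0) : φ = 0 := by
  obtain ⟨hJ, h, hd, hr⟩ := hφ
  change IsJacobiForm k m M φ at hJ
  have hdec (τ : ℍ) : φ τ = fun z => h 0 τ * thetaJ m 0 τ z + h m τ * thetaJ m m τ z := by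
    funext z
    rw [hd τ z]
    refine Finset.sum_eq_add_of_mem _ _ (by simp [hm]) (by simp; omega) hm.ne fun r hr1 hr2 => ?_
    rw [hr r (Finset.mem_range.1 hr1) hr2.1 hr2.2, Pi.zero_apply, zero_mul]
  have hzz (τ : ℍ) : iteratedDeriv 2 (φ τ) 0 = 0 := by
    have e : (fun w : ℂ => φ (ofComplex w) 0) = fun _ => 0 :=
      funext fun w => congrFun h0 (ofComplex w)
    have := congrFun h2 τ
    rw [jacobiD2, e, deriv_const, mul_zero, sub_zero, Pi.zero_apply] at this
    refine (mul_eq_zero.1 this).resolve_left ?_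
    have := Real.pi_ne_zero
    simp [hk]
  have hvan : ∀ᶠ y : ℝ in Filter.atTop, ∀ z, φ (ofComplex (Complex.I * y)) z = 0 := by
    filter_upwards [eventually_thetaMoment_det_pos hm, Filter.eventually_gt_atTop 0] with y hy hy0
    set τ : ℍ := ofComplex (Complex.I * y) with hτd
    have hc : (τ : ℂ) = Complex.I * y := by
      rw [hτd, ofComplex_apply_of_im_pos (by simpa using hy0)]
    have hi : τ.im = y := by rw [← coe_im, hc]; simp
    have hτ : (τ : ℂ) = Complex.I * τ.im := by rw [hi, hc]
    have e0 : φ τ 0 = 0 := congrFun h0 τ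
    have e2 := hzz τ
    have cd (r : ℕ) : ContDiffAt ℂ 2 (fun z => h r τ * thetaJ m r τ z) 0 :=
      ((differentiable_thetaJ hm r τ).contDiff.const_smul (h r τ)).contDiffAt
    rw [hdec] at e0 e2
    rw [iteratedDeriv_fun_add (cd 0) (cd m), iteratedDeriv_const_mul_field,
      iteratedDeriv_const_mul_field, iteratedDeriv_two_thetaJ hm 0 hτ,
      iteratedDeriv_two_thetaJ hm m hτ, hi] at e2
    simp only [thetaJ_zero_of_re_eq_zero m _ hτ, hi] at e0
    have hq : (4 * Real.pi * Complex.I * m : ℂ) ^ 2 ≠ 0 := by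
      have := Real.pi_ne_zero
      simp [hm.ne']
    have e2' : h 0 τ * thetaMoment m 0 1 y + h m τ * thetaMoment m m 1 y = 0 := by
      refine (mul_eq_zero.1 ?_).resolve_left hq
      linear_combination e2
    have hdet : (thetaMoment m 0 0 y * thetaMoment m m 1 y -
        thetaMoment m m 0 y * thetaMoment m 0 1 y : ℂ) ≠ 0 := by exact_mod_cast hy.ne'
    -- Cramer's rule for the system `e0`, `e2'`.
    have a0 : h 0 τ = 0 := by
      refine (mul_eq_zero.1 ?_).resolve_right hdet
      linear_combination (thetaMoment m m 1 y : ℂ) * e0 - (thetaMoment m m 0 y : ℂ) * e2'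
    have am : h m τ = 0 := by
      refine (mul_eq_zero.1 ?_).resolve_right hdet
      linear_combination (thetaMoment m 0 0 y : ℂ) * e2' - (thetaMoment m 0 1 y : ℂ) * e0
    intro z
    rw [congrFun (hdec τ) z, a0, am, zero_mul, zero_mul, add_zero]
  obtain ⟨Y, hY⟩ := Filter.eventually_atTop.1 hvan
  funext τ z
  -- The identity theorem is applied to `φ(·, z)`, so no holomorphy of the `h r` is needed.
  have hmd : MDiff fun τ : ℍ => φ τ z := by
    rw [UpperHalfPlane.mdifferentiable_iff]
    exact fun w hw => (hJ.differentiableAt_left z hw).differentiableWithinAt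
  exact congrFun (eq_zero_of_imaginary_axis hmd fun y hy => hY y hy z) τ

end Injectivity

/-! ### Construction of the linear map -/

section Main

variable {k : ℤ} {m M : ℕ} {φ : ℍ → ℂ → ℂ}

lemma IsJacobiForm.exists_expansion (h : IsJacobiForm k m M φ) (γ : SL(2, ℤ)) :
    ∃ c, HasJacobiExpansion m M (jacobiSlash k m γ φ) c :=
  (h.fourier γ).imp fun _ hc => ⟨hc.1, hc.2⟩

lemma IsJacobiForm.jacobiSlash_eq (h : IsJacobiForm k m M φ) {γ : SL(2, ℤ)}
    (hγ : γ ∈ CongruenceSubgroup.Gamma0 M) : jacobiSlash k m γ φ = φ :=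
  funext fun τ => funext fun z => h.slash γ hγ τ z

lemma IsJacobiForm.exists_expansion_self (h : IsJacobiForm k m M φ) :
    ∃ c, HasJacobiExpansion m M φ c := by
  simpa only [h.jacobiSlash_eq (one_mem _)] using h.exists_expansion 1

/-- `D₀ φ` as a modular form. -/
noncomputable def IsJacobiForm.modularForm (h : IsJacobiForm k m M φ) (hm : 0 < m) (hM : 0 < M) :
    ModularForm (CongruenceSubgroup.Gamma0 M) k where
  toFun := jacobiD0 φ
  slash_action_eq' := by
    rintro _ ⟨γ, hγ, rfl⟩
    change jacobiD0 φ ∣[k] γ = _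
    rw [← jacobiD0_jacobiSlash k m, h.jacobiSlash_eq hγ]
  holo' := h.exists_expansion_self.elim fun _ hc => hc.mdifferentiable_jacobiD0
  bdd_at_cusps' := by
    intro c hc
    have : NeZero M := ⟨hM.ne'⟩
    -- The cusps are the `SL₂(ℤ)`-translates of `∞`, so the condition becomes one at `i∞` for each
    -- slash by `γ`.
    rw [Subgroup.IsArithmetic.isCusp_iff_isCusp_SL2Z] at hc
    refine (OnePoint.isBoundedAt_iff_forall_SL2Z hc).2 fun γ _ => ?_
    obtain ⟨c, hc⟩ := h.exists_expansion γ
    rw [← jacobiD0_jacobiSlash k m]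
    exact hc.isBoundedAtImInfty_jacobiD0 hm hM

/-- `D₂ φ` as a cusp form. -/
noncomputable def IsJacobiForm.cuspForm (h : IsJacobiForm k m M φ) (hm : 0 < m) (hM : 0 < M) :
    CuspForm (CongruenceSubgroup.Gamma0 M) (k + 2) where
  toFun := jacobiD2 k m φ
  slash_action_eq' := by
    rintro _ ⟨γ, hγ, rfl⟩
    change jacobiD2 k m φ ∣[k + 2] γ = _
    rw [← jacobiD2_jacobiSlash h, h.jacobiSlash_eq hγ]
  holo' := h.exists_expansion_self.elim fun _ hc => hc.mdifferentiable_jacobiD2 k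
  zero_at_cusps' := by
    intro c hc
    have : NeZero M := ⟨hM.ne'⟩
    rw [Subgroup.IsArithmetic.isCusp_iff_isCusp_SL2Z] at hc
    refine (OnePoint.isZeroAt_iff_forall_SL2Z hc).2 fun γ _ => ?_
    obtain ⟨c, hc⟩ := h.exists_expansion γ
    change IsZeroAtImInfty (jacobiD2 k m φ ∣[k + 2] γ)
    rw [← jacobiD2_jacobiSlash h]
    exact hc.isZeroAtImInfty_jacobiD2 k hm hM

lemma jacobiD2_add {ψ : ℍ → ℂ → ℂ} (hφ : IsJacobiForm k m M φ) (hψ : IsJacobiForm k m M ψ) (τ : ℍ) :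
    jacobiD2 k m (φ + ψ) τ = jacobiD2 k m φ τ + jacobiD2 k m ψ τ := by
  have e1 := iteratedDeriv_fun_add (n := 2) (x := (0 : ℂ))
    (hφ.differentiable_right τ).contDiff.contDiffAt (hψ.differentiable_right τ).contDiff.contDiffAt
  have e2 := deriv_fun_add (hφ.differentiableAt_left 0 τ.im_pos)
    (hψ.differentiableAt_left 0 τ.im_pos)
  simp only [jacobiD2, Pi.add_apply]
  rw [e1, e2]
  ring

lemma jacobiD2_smul (a : ℂ) (τ : ℍ) : jacobiD2 k m (a • φ) τ = a * jacobiD2 k m φ τ := by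
  simp only [jacobiD2, Pi.smul_apply, smul_eq_mul]
  rw [iteratedDeriv_const_mul_field, deriv_const_mul_field]
  ring

end Main

theorem corollary4p3 (k : ℤ) (m N : ℕ) (hk : 0 < k) (hm : Squarefree m) (hN : 0 < N) :
    ∃ D : jacobiFormsStar k m (m * N) →ₗ[ℂ]
        ModularForm (CongruenceSubgroup.Gamma0 (m * N)) k ×
          CuspForm (CongruenceSubgroup.Gamma0 (m * N)) (k + 2),
      (∀ (φ : jacobiFormsStar k m (m * N)) (τ : ℍ), (D φ).1 τ = jacobiD0 φ.1 τ) ∧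
      (∀ (φ : jacobiFormsStar k m (m * N)) (τ : ℍ), (D φ).2 τ = jacobiD2 k m φ.1 τ) ∧
      Function.Injective D := by
  have hm0 : 0 < m := Nat.pos_of_ne_zero hm.ne_zero
  have hM : 0 < m * N := Nat.mul_pos hm0 hN
  have hJ (φ : jacobiFormsStar k m (m * N)) : IsJacobiForm k m (m * N) φ.1 := φ.2.1
  refine ⟨{ toFun := fun φ => ((hJ φ).modularForm hm0 hM, (hJ φ).cuspForm hm0 hM)
            map_add' := fun φ ψ => Prod.ext (DFunLike.ext _ _ fun τ => rfl)
              (DFunLike.ext _ _ fun τ => jacobiD2_add (hJ φ) (hJ ψ) τ)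
            map_smul' := fun a φ => Prod.ext (DFunLike.ext _ _ fun τ => rfl)
              (DFunLike.ext _ _ fun τ => jacobiD2_smul a τ) },
    fun φ τ => rfl, fun φ τ => rfl, ?_⟩
  rw [injective_iff_map_eq_zero]
  intro φ hφ
  refine Subtype.ext (eq_zero_of_jacobiD0_eq_zero_of_jacobiD2_eq_zero hk.ne' hm0 φ.2
    (funext fun τ => ?_) (funext fun τ => ?_))
  · exact DFunLike.congr_fun (congrArg Prod.fst hφ) τ
  · exact DFunLike.congr_fun (congrArg Prod.snd hφ) τ
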